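/- Let $\Bbbk$ be a field, $H$ a Hopf algebra over $\Bbbk$, and $A$ a right $H$-comodule algebra (unital, associative) with coaction $\varrho^A:A\to A\otimes H$ and subalgebra of coinvariants $B=A^{coH}=\{b\in A: \varrho^A(b)=b\otimes 1\}$. Assume that $B\subseteq A$ is a Hopf–Galois extension, i.e. that the map $A\otimes_B A\to A\otimes H$, $a\otimes_B a'\mapsto a\,\varrho^A(a')$, is bijective, and that $A$ is faithfully flat as a left $B$-module. A relative Hopf module is a right $A$-module and right $H$-comodule $M$ (over $\Bbbk$) with $\varrho^M(ma)=m_{(0)}a_{(0)}\otimes m_{(1)}a_{(1)}$; put $M^{coH}=\{m\in M:\varrho^M(m)=m\otimes 1\}$, which is a right $B$-module. Let $(\Omega^1(A),d)$ be a covariant first order differential calculus on $A$: an $A$-bimodule $\Omega^1(A)$ with a $\Bbbk$-linear map $d:A\to\Omega^1(A)$ satisfying $d(ab)=(da)b+a\,db$, such that $\Omega^1(A)$ is a relative Hopf module and $d$ is right $H$-colinear. Let $\Omega^1(B)=B\,dB\subseteq\Omega^1(A)$ be the $B$-bimodule spanned by all $b\,db'$ with $b,b'\in B$, with the restricted differential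 $d:B\to\Omega^1(B)$, and give $\Omega^1(B)\otimes_BA$ the coaction $\omega\otimes_B a\mapsto \omega\otimes_B\varrho^A(a)$. Let $$j:\Omega^1(B)\otimes_B A\to\Omega^1(A),\qquad \omega\otimes_B a\mapsto\omega a,$$ and assume that there is a left $B$-linear, right $A$-linear, right $H$-colinear map $\Pi:\Omega^1(A)\to\Omega^1(B)\otimes_BA$ with $\Pi\circ j=\mathrm{id}$. A hom-connection on a right $A$-module $M$ with respect to $\Omega^1(A)$ is a $\Bbbk$-linear map $\nabla:\mathrm{Hom}_A(\Omega^1(A),M)\to M$ (right $A$-linear maps) with $\nabla(fa)=\nabla(f)a+f(da)$ for all $f$ and all $a\in A$, where $(fa)(\omega)=f(a\omega)$; hom-connections with respect to $\Omega^1(B)$ are defined in the same way, with $B$ in place of $A$. **Theorem.** Let $M$ be a relative Hopf module and let $\nabla$ be a hom-connection on $M$ with respect to $\Omega^1(A)$ such that $\nabla(f)\in M^{coH}$ for every right $A$-linear, right $H$-colinear map $f:\Omega^1(A)\to M$. Then $\nabla$ induces a hom-connection $\nabla^{coH}:\mathrm{Hom}_B(\Omega^1(B),M^{coH})\to M^{coH}$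 on $M^{coH}$ with respect to $\Omega^1(B)$, given by $$\nabla^{coH}(f)=\nabla(\widehat f\circ\Pi),\qquad \widehat f:\Omega^1(B)\otimes_BA\to M,\quad \widehat f(\omega\otimes_B a)=f(\omega)a .$$ -/

import Mathlib

open scoped TensorProduct
open MulOpposite (op)

set_option linter.unusedSectionVars false

universe u v w x y

/-! Right modules over an algebra `A` are modules over `Aᵐᵒᵖ`; `m · a` is `op a • m`. -/

section Comodules

/-- Right comodules over a coalgebra `H`. -/
class RightComodule (k : Type u) (H : Type w) (M : Type x) [CommRing k] [AddCommGroup H]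
    [Module k H] [Coalgebra k H] [AddCommGroup M] [Module k M] where
  coact : M →ₗ[k] M ⊗[k] H
  coassoc : ∀ m : M, TensorProduct.assoc k M H H (coact.rTensor H (coact m)) =
    (Coalgebra.comul (R := k) (A := H)).lTensor M (coact m)
  counit : ∀ m : M, (Coalgebra.counit (R := k) (A := H)).lTensor M (coact m) = m ⊗ₜ[k] (1 : k)

/-- The coaction `ϱ : M → M ⊗ H` of a right `H`-comodule. -/
abbrev coact (k : Type u) (H : Type w) (M : Type x) [CommRing k] [AddCommGroup H]
    [Module k H] [Coalgebra k H] [AddCommGroup M] [Module k M] [RightComodule k H M] :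
    M →ₗ[k] M ⊗[k] H := RightComodule.coact

/-- Right `H`-colinear maps. -/
def IsColinear (k : Type u) (H : Type w) {M : Type x} {N : Type y} [CommRing k] [AddCommGroup H]
    [Module k H] [Coalgebra k H] [AddCommGroup M] [Module k M] [RightComodule k H M]
    [AddCommGroup N] [Module k N] [RightComodule k H N] (f : M →ₗ[k] N) : Prop :=
  ∀ m : M, coact k H N (f m) = f.rTensor H (coact k H M m)

/-- Right `H`-comodule algebras: the coaction `A → A ⊗ H` is a homomorphism of algebras. -/
class ComoduleAlgebra (k : Type u) (H : Type w) (A : Type v) [CommRing k] [Ring H]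
    [HopfAlgebra k H] [Ring A] [Algebra k A] extends RightComodule k H A where
  coact_one : coact (1 : A) = 1
  coact_mul : ∀ a b : A, coact (a * b) = coact a * coact b

/-- The right action of an algebra on a right module, as a bilinear map. -/
def rightAct (k : Type u) (A : Type v) (M : Type x) [CommRing k] [Ring A] [Algebra k A]
    [AddCommGroup M] [Module k M] [Module Aᵐᵒᵖ M] [IsScalarTower k Aᵐᵒᵖ M] : M →ₗ[k] A →ₗ[k] M :=
  LinearMap.mk₂ k (fun m a => op a • m) (fun _ _ _ => smul_add _ _ _)
    (fun c m a => by rw [smul_comm])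
    (fun m a b => by rw [MulOpposite.op_add, add_smul])
    (fun c m a => by rw [MulOpposite.op_smul, smul_assoc])

/-- Relative Hopf modules: `ϱ (m a) = m₀ a₀ ⊗ m₁ a₁`. -/
class RelativeHopfModule (k : Type u) (H : Type w) (A : Type v) (M : Type x) [CommRing k] [Ring H]
    [HopfAlgebra k H] [Ring A] [Algebra k A] [ComoduleAlgebra k H A] [AddCommGroup M] [Module k M]
    [Module Aᵐᵒᵖ M] [IsScalarTower k Aᵐᵒᵖ M] [RightComodule k H M] : Prop where
  coact_smul : ∀ (m : M) (a : A), coact k H M (op a • m) =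
    TensorProduct.map₂ (rightAct k A M) (LinearMap.mul k H) (coact k H M m) (coact k H A a)

variable (k : Type u) (H : Type w) (A : Type v) [CommRing k] [Ring H] [HopfAlgebra k H] [Ring A]
  [Algebra k A] [ComoduleAlgebra k H A]

/-- The subalgebra `B = A^{coH}` of coinvariants. -/
def coinvariantAlgebra : Subalgebra k A where
  carrier := {a | coact k H A a = a ⊗ₜ[k] (1 : H)}
  mul_mem' {a b} ha hb := by
    simp only [Set.mem_ofPred_eq] at *
    rw [ComoduleAlgebra.coact_mul, ha, hb, Algebra.TensorProduct.tmul_mul_tmul, one_mul]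
  add_mem' {a b} ha hb := by
    simp only [Set.mem_ofPred_eq] at *
    rw [map_add, ha, hb, TensorProduct.add_tmul]
  algebraMap_mem' c := by
    simp only [Set.mem_ofPred_eq]
    rw [Algebra.algebraMap_eq_smul_one, map_smul, ComoduleAlgebra.coact_one,
      Algebra.TensorProduct.one_def, TensorProduct.smul_tmul']

theorem coact_coinvariant (b : coinvariantAlgebra k H A) :
    coact k H A (b : A) = (b : A) ⊗ₜ[k] (1 : H) := b.2

/-- Restriction of a right action to a subalgebra. -/
instance rightModuleOfSubalgebra {k : Type u} {A : Type v} [CommRing k] [Ring A] [Algebra k A]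
    (S : Subalgebra k A) (M : Type x) [AddCommGroup M] [Module Aᵐᵒᵖ M] : Module (↥S)ᵐᵒᵖ M :=
  Module.compHom M (RingHom.op S.val.toRingHom)

theorem op_subalgebra_smul {k : Type u} {A : Type v} [CommRing k] [Ring A] [Algebra k A]
    (S : Subalgebra k A) {M : Type x} [AddCommGroup M] [Module Aᵐᵒᵖ M] (b : S) (m : M) :
    op b • m = op (b : A) • m := rfl

instance {k : Type u} {A : Type v} [CommRing k] [Ring A] [Algebra k A] (S : Subalgebra k A)
    (M : Type x) [AddCommGroup M] [Module k M] [Module Aᵐᵒᵖ M] [IsScalarTower k Aᵐᵒᵖ M] :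
    IsScalarTower k (↥S)ᵐᵒᵖ M where
  smul_assoc c b m := by
    obtain ⟨b, rfl⟩ := MulOpposite.op_surjective b
    change op ((c • b : S) : A) • m = c • (op (b : A) • m)
    rw [Subalgebra.coe_smul, MulOpposite.op_smul, smul_assoc]

/-- The coinvariants `M^{coH} = {m | ϱ m = m ⊗ 1}` of a comodule. -/
def coinvariants (M : Type x) [AddCommGroup M] [Module k M] [RightComodule k H M] :
    Submodule k M where
  carrier := {m | coact k H M m = m ⊗ₜ[k] (1 : H)}
  add_mem' {a b} ha hb := by
    simp only [Set.mem_ofPred_eq] at *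
    rw [map_add, ha, hb, TensorProduct.add_tmul]
  zero_mem' := by simp
  smul_mem' c m hm := by
    simp only [Set.mem_ofPred_eq] at *
    rw [map_smul, hm, TensorProduct.smul_tmul']

variable {k H A} in
theorem op_smul_mem_coinvariants {M : Type x} [AddCommGroup M] [Module k M] [Module Aᵐᵒᵖ M]
    [IsScalarTower k Aᵐᵒᵖ M] [RightComodule k H M] [RelativeHopfModule k H A M]
    (b : coinvariantAlgebra k H A) {m : M} (hm : m ∈ coinvariants k H M) :
    op (b : A) • m ∈ coinvariants k H M := by
  change coact k H M m = _ at hm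
  change coact k H M (op (b : A) • m) = _
  rw [RelativeHopfModule.coact_smul, hm, coact_coinvariant, TensorProduct.map₂_apply_tmul]
  simp [rightAct]

/-- The right `B`-module structure of `M^{coH}`. -/
instance (M : Type x) [AddCommGroup M] [Module k M] [Module Aᵐᵒᵖ M]
    [IsScalarTower k Aᵐᵒᵖ M] [RightComodule k H M] [RelativeHopfModule k H A M] :
    Module (↥(coinvariantAlgebra k H A))ᵐᵒᵖ (coinvariants k H M) where
  smul b m := ⟨b • (m : M), op_smul_mem_coinvariants b.unop m.2⟩
  one_smul m := Subtype.ext (one_smul _ (m : M))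
  mul_smul b c m := Subtype.ext (mul_smul b c (m : M))
  smul_zero b := Subtype.ext (smul_zero b)
  smul_add b m n := Subtype.ext (smul_add b (m : M) n)
  add_smul b c m := Subtype.ext (add_smul b c (m : M))
  zero_smul m := Subtype.ext (zero_smul _ (m : M))

instance (M : Type x) [AddCommGroup M] [Module k M] [Module Aᵐᵒᵖ M]
    [IsScalarTower k Aᵐᵒᵖ M] [RightComodule k H M] [RelativeHopfModule k H A M] :
    IsScalarTower k (↥(coinvariantAlgebra k H A))ᵐᵒᵖ (coinvariants k H M) where
  smul_assoc c b m := Subtype.ext (smul_assoc c b (m : M))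

end Comodules

section BalancedTensor

variable (k : Type u) (B : Type v) (N : Type x) (P : Type y) [CommRing k] [Ring B] [Algebra k B]
  [AddCommGroup N] [Module k N] [Module Bᵐᵒᵖ N] [AddCommGroup P] [Module k P] [Module B P]

/-- The relations `n b ⊗ p - n ⊗ b p` in `N ⊗ₖ P`. -/
def balancedRel : Submodule k (N ⊗[k] P) :=
  Submodule.span k {t | ∃ (n : N) (b : B) (p : P), t = (op b • n) ⊗ₜ[k] p - n ⊗ₜ[k] (b • p)}

/-- The tensor product `N ⊗_B P` of a right and a left module over a possibly noncommutative
`k`-algebra `B`. -/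
def BTensor : Type max x y := (N ⊗[k] P) ⧸ balancedRel k B N P

namespace BTensor

instance : AddCommGroup (BTensor k B N P) :=
  inferInstanceAs (AddCommGroup ((N ⊗[k] P) ⧸ balancedRel k B N P))

instance : Module k (BTensor k B N P) :=
  inferInstanceAs (Module k ((N ⊗[k] P) ⧸ balancedRel k B N P))

/-- The canonical projection `N ⊗ₖ P → N ⊗_B P`. -/
def proj : N ⊗[k] P →ₗ[k] BTensor k B N P := (balancedRel k B N P).mkQ

variable {N P} in
/-- The pure tensor `n ⊗_B p`. -/
def tmul (n : N) (p : P) : BTensor k B N P := proj k B N P (n ⊗ₜ[k] p)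

/-- The universal balanced map as a bilinear map. -/
def mk : N →ₗ[k] P →ₗ[k] BTensor k B N P := (TensorProduct.mk k N P).compr₂ (proj k B N P)

@[simp] theorem mk_apply (n : N) (p : P) : mk k B N P n p = tmul k B n p := rfl

variable {k B N P}

theorem add_tmul (n n' : N) (p : P) : tmul k B (n + n') p = tmul k B n p + tmul k B n' p :=
  LinearMap.map_add₂ (mk k B N P) n n' p

theorem tmul_add (n : N) (p p' : P) : tmul k B n (p + p') = tmul k B n p + tmul k B n p' :=
  map_add (mk k B N P n) p p'

theorem zero_tmul (p : P) : tmul k B (0 : N) p = 0 := LinearMap.map_zero₂ (mk k B N P) p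

theorem tmul_zero (n : N) : tmul k B n (0 : P) = 0 := map_zero (mk k B N P n)

theorem tmul_smul (c : k) (n : N) (p : P) : tmul k B n (c • p) = c • tmul k B n p :=
  map_smul (mk k B N P n) c p

theorem op_smul_tmul (b : B) (n : N) (p : P) : tmul k B (op b • n) p = tmul k B n (b • p) :=
  (Submodule.Quotient.eq _).2 (Submodule.subset_span ⟨n, b, p, rfl⟩)

/-- A balanced bilinear map induces a map on `N ⊗_B P`. -/
def lift {X : Type w} [AddCommGroup X] [Module k X] (φ : N →ₗ[k] P →ₗ[k] X)
    (h : ∀ (n : N) (b : B) (p : P), φ (op b • n) p = φ n (b • p)) : BTensor k B N P →ₗ[k] X :=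
  (balancedRel k B N P).liftQ (TensorProduct.lift φ) (by
    refine Submodule.span_le.2 ?_
    rintro _ ⟨n, b, p, rfl⟩
    simp [h])

@[simp] theorem lift_tmul {X : Type w} [AddCommGroup X] [Module k X] (φ : N →ₗ[k] P →ₗ[k] X)
    (h : ∀ (n : N) (b : B) (p : P), φ (op b • n) p = φ n (b • p)) (n : N) (p : P) :
    lift φ h (tmul k B n p) = φ n p := rfl

@[ext] theorem hom_ext {X : Type w} [AddCommGroup X] [Module k X] {f g : BTensor k B N P →ₗ[k] X}
    (h : ∀ n p, f (tmul k B n p) = g (tmul k B n p)) : f = g :=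
  Submodule.linearMap_qext _ (TensorProduct.ext' h)

section Map

variable {N' : Type x} {P' : Type y} [AddCommGroup N'] [Module k N'] [Module Bᵐᵒᵖ N']
  [AddCommGroup P'] [Module k P'] [Module B P'] [IsScalarTower k Bᵐᵒᵖ N] [IsScalarTower k Bᵐᵒᵖ N']
  [IsScalarTower k B P] [IsScalarTower k B P']

/-- Functoriality: `f ⊗_B g`. -/
def map (f : N →ₗ[Bᵐᵒᵖ] N') (g : P →ₗ[B] P') : BTensor k B N P →ₗ[k] BTensor k B N' P' :=
  lift (((TensorProduct.mk k N' P').compr₂ (proj k B N' P')).compl₁₂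
    (f.restrictScalars k) (g.restrictScalars k)) (fun n b p => by
      change tmul k B (f (op b • n)) (g p) = tmul k B (f n) (g (b • p))
      rw [map_smul, map_smul, op_smul_tmul])

@[simp] theorem map_tmul (f : N →ₗ[Bᵐᵒᵖ] N') (g : P →ₗ[B] P') (n : N) (p : P) :
    map (k := k) f g (tmul k B n p) = tmul k B (f n) (g p) := rfl

end Map

section RightAction

variable {A : Type w} [Ring A] [Algebra k A] [Module Aᵐᵒᵖ P] [SMulCommClass Aᵐᵒᵖ B P]
  [IsScalarTower k Bᵐᵒᵖ N] [IsScalarTower k B P] [IsScalarTower k Aᵐᵒᵖ P]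

/-- If `P` is a `(B, A)`-bimodule, then `N ⊗_B P` is a right `A`-module. -/
instance : Module Aᵐᵒᵖ (BTensor k B N P) where
  smul a t := map (k := k) LinearMap.id (DistribSMul.toLinearMap B P a) t
  one_smul t := by
    have : map (k := k) (N := N) LinearMap.id (DistribSMul.toLinearMap B P (1 : Aᵐᵒᵖ)) =
        LinearMap.id := by ext; simp
    exact congr($this t)
  mul_smul a b t := by
    have : map (k := k) (N := N) LinearMap.id (DistribSMul.toLinearMap B P (a * b)) =
        map (k := k) LinearMap.id (DistribSMul.toLinearMap B P a) ∘ₗ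
          map (k := k) LinearMap.id (DistribSMul.toLinearMap B P b) := by ext; simp [mul_smul]
    exact congr($this t)
  smul_zero a := map_zero (map (k := k) (N := N) LinearMap.id (DistribSMul.toLinearMap B P a))
  smul_add a := map_add (map (k := k) (N := N) LinearMap.id (DistribSMul.toLinearMap B P a))
  add_smul a b t := by
    have : map (k := k) (N := N) LinearMap.id (DistribSMul.toLinearMap B P (a + b)) =
        map (k := k) LinearMap.id (DistribSMul.toLinearMap B P a) +
          map (k := k) LinearMap.id (DistribSMul.toLinearMap B P b) := by
      ext; simp [add_smul, tmul_add]
    exact congr($this t)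
  zero_smul t := by
    have : map (k := k) (N := N) LinearMap.id (DistribSMul.toLinearMap B P (0 : Aᵐᵒᵖ)) = 0 := by
      ext; simp [tmul_zero]
    exact congr($this t)

@[simp] theorem op_smul_tmul_right (a : Aᵐᵒᵖ) (n : N) (p : P) :
    a • tmul k B n p = tmul k B n (a • p) := rfl

instance : IsScalarTower k Aᵐᵒᵖ (BTensor k B N P) where
  smul_assoc c a t := by
    have : map (k := k) (N := N) LinearMap.id (DistribSMul.toLinearMap B P (c • a)) =
        c • map (k := k) LinearMap.id (DistribSMul.toLinearMap B P a) := by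
      ext; simp [tmul_smul]
    exact congr($this t)

end RightAction

section LeftAction

variable [Module B N] [SMulCommClass B Bᵐᵒᵖ N] [IsScalarTower k B N]
  [IsScalarTower k Bᵐᵒᵖ N] [IsScalarTower k B P]

/-- If `N` is a `B`-bimodule, then `N ⊗_B P` is a left `B`-module. -/
instance : Module B (BTensor k B N P) where
  smul a t := map (k := k) (DistribSMul.toLinearMap Bᵐᵒᵖ N a) LinearMap.id t
  one_smul t := by
    have : map (k := k) (P := P) (DistribSMul.toLinearMap Bᵐᵒᵖ N (1 : B)) LinearMap.id =
        LinearMap.id := by ext; simp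
    exact congr($this t)
  mul_smul a b t := by
    have : map (k := k) (P := P) (DistribSMul.toLinearMap Bᵐᵒᵖ N (a * b)) LinearMap.id =
        map (k := k) (DistribSMul.toLinearMap Bᵐᵒᵖ N a) LinearMap.id ∘ₗ
          map (k := k) (DistribSMul.toLinearMap Bᵐᵒᵖ N b) LinearMap.id := by ext; simp [mul_smul]
    exact congr($this t)
  smul_zero a := map_zero (map (k := k) (P := P) (DistribSMul.toLinearMap Bᵐᵒᵖ N a) LinearMap.id)
  smul_add a := map_add (map (k := k) (P := P) (DistribSMul.toLinearMap Bᵐᵒᵖ N a) LinearMap.id)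
  add_smul a b t := by
    have : map (k := k) (P := P) (DistribSMul.toLinearMap Bᵐᵒᵖ N (a + b)) LinearMap.id =
        map (k := k) (DistribSMul.toLinearMap Bᵐᵒᵖ N a) LinearMap.id +
          map (k := k) (DistribSMul.toLinearMap Bᵐᵒᵖ N b) LinearMap.id := by
      ext; simp [add_smul, add_tmul]
    exact congr($this t)
  zero_smul t := by
    have : map (k := k) (P := P) (DistribSMul.toLinearMap Bᵐᵒᵖ N (0 : B)) LinearMap.id = 0 := by
      ext; simp [zero_tmul]
    exact congr($this t)

@[simp] theorem smul_tmul_left (b : B) (n : N) (p : P) :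
    b • tmul k B n p = tmul k B (b • n) p := rfl

end LeftAction

end BTensor

/-- `P` is a faithfully flat left `B`-module: a sequence of right `B`-modules is exact if and only
if it is exact after applying `- ⊗_B P`. (A right `B`-module carries a unique `k`-module structure
compatible with its `B`-action.) -/
def IsFaithfullyFlatLeft [IsScalarTower k B P] : Prop :=
  ∀ (N₁ N₂ N₃ : Type v) [AddCommGroup N₁] [AddCommGroup N₂] [AddCommGroup N₃]
    [Module k N₁] [Module k N₂] [Module k N₃] [Module Bᵐᵒᵖ N₁] [Module Bᵐᵒᵖ N₂] [Module Bᵐᵒᵖ N₃]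
    [IsScalarTower k Bᵐᵒᵖ N₁] [IsScalarTower k Bᵐᵒᵖ N₂] [IsScalarTower k Bᵐᵒᵖ N₃]
    (f : N₁ →ₗ[Bᵐᵒᵖ] N₂) (g : N₂ →ₗ[Bᵐᵒᵖ] N₃),
    Function.Exact f g ↔
      Function.Exact (BTensor.map (k := k) f (LinearMap.id : P →ₗ[B] P))
        (BTensor.map (k := k) g (LinearMap.id : P →ₗ[B] P))

end BalancedTensor

section HopfGalois

variable (k : Type u) (H : Type w) (A : Type v) [CommRing k] [Ring H] [HopfAlgebra k H] [Ring A]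
  [Algebra k A] [ComoduleAlgebra k H A]

theorem coact_coinvariant_smul (b : coinvariantAlgebra k H A) (a : A) :
    coact k H A (b • a) = ((b : A) ⊗ₜ[k] (1 : H)) * coact k H A a := by
  change coact k H A ((b : A) * a) = _
  rw [ComoduleAlgebra.coact_mul, coact_coinvariant]

/-- The canonical map `A ⊗_B A → A ⊗ H`, `a ⊗_B a' ↦ a ϱ(a')`. -/
def canonicalMap : BTensor k (coinvariantAlgebra k H A) A A →ₗ[k] A ⊗[k] H :=
  BTensor.lift ((LinearMap.mul k (A ⊗[k] H)).compl₁₂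
    (Algebra.TensorProduct.includeLeft : A →ₐ[k] A ⊗[k] H).toLinearMap (coact k H A))
    (fun a b a' => by
      change ((a * (b : A)) ⊗ₜ[k] (1 : H)) * coact k H A a' =
        (a ⊗ₜ[k] (1 : H)) * coact k H A (b • a')
      rw [coact_coinvariant_smul, ← mul_assoc, Algebra.TensorProduct.tmul_mul_tmul, one_mul])

/-- `A^{coH} ⊆ A` is a Hopf-Galois extension. -/
def IsHopfGalois : Prop := Function.Bijective (canonicalMap k H A)

/-- A balanced map which is right `A`-linear in the second variable induces a right `A`-linear map
on `N ⊗_B A`. -/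
def BTensor.liftRight {k : Type u} {A : Type v} [CommRing k] [Ring A] [Algebra k A]
    {S : Subalgebra k A} {N : Type x} [AddCommGroup N] [Module k N] [Module (↥S)ᵐᵒᵖ N]
    [IsScalarTower k (↥S)ᵐᵒᵖ N] {X : Type y} [AddCommGroup X] [Module k X] [Module Aᵐᵒᵖ X]
    [IsScalarTower k Aᵐᵒᵖ X] (φ : N →ₗ[k] A →ₗ[k] X)
    (h : ∀ (n : N) (b : S) (a : A), φ (op b • n) a = φ n (b • a))
    (h' : ∀ (n : N) (a a' : A), φ n (a * a') = op a' • φ n a) :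
    BTensor k S N A →ₗ[Aᵐᵒᵖ] X where
  toFun := BTensor.lift φ h
  map_add' := map_add _
  map_smul' a t := by
    have : BTensor.lift φ h ∘ₗ BTensor.map (k := k) LinearMap.id (DistribSMul.toLinearMap S A a) =
        a • BTensor.lift φ h := by
      ext n a'
      exact h' n a' a.unop
    exact congr($this t)

@[simp] theorem BTensor.liftRight_tmul {k : Type u} {A : Type v} [CommRing k] [Ring A]
    [Algebra k A] {S : Subalgebra k A} {N : Type x} [AddCommGroup N] [Module k N]
    [Module (↥S)ᵐᵒᵖ N] [IsScalarTower k (↥S)ᵐᵒᵖ N] {X : Type y} [AddCommGroup X] [Module k X]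
    [Module Aᵐᵒᵖ X] [IsScalarTower k Aᵐᵒᵖ X] (φ : N →ₗ[k] A →ₗ[k] X)
    (h : ∀ (n : N) (b : S) (a : A), φ (op b • n) a = φ n (b • a))
    (h' : ∀ (n : N) (a a' : A), φ n (a * a') = op a' • φ n a) (n : N) (a : A) :
    BTensor.liftRight φ h h' (BTensor.tmul k S n a) = φ n a := rfl

variable (N : Type x) [AddCommGroup N] [Module k N] [Module (↥(coinvariantAlgebra k H A))ᵐᵒᵖ N]
  [IsScalarTower k (↥(coinvariantAlgebra k H A))ᵐᵒᵖ N]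

/-- The coaction `n ⊗_B a ↦ n ⊗_B ϱ(a)` on `N ⊗_B A`. -/
def inducedCoact : BTensor k (coinvariantAlgebra k H A) N A →ₗ[k]
    BTensor k (coinvariantAlgebra k H A) N A ⊗[k] H :=
  BTensor.lift
    (((LinearMap.rTensorHom H).comp (BTensor.mk k (coinvariantAlgebra k H A) N A)).compl₂
      (coact k H A))
    (fun n b a => by
      change (BTensor.mk k _ N A (op b • n)).rTensor H (coact k H A a) =
        (BTensor.mk k _ N A n).rTensor H (coact k H A (b • a))
      rw [coact_coinvariant_smul]
      induction coact k H A a with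
      | zero => simp
      | add s t hs ht => rw [mul_add, map_add, map_add, hs, ht]
      | tmul a h =>
        rw [Algebra.TensorProduct.tmul_mul_tmul, one_mul, LinearMap.rTensor_tmul,
          LinearMap.rTensor_tmul, BTensor.mk_apply, BTensor.mk_apply, BTensor.op_smul_tmul]
        rfl)

theorem inducedCoact_tmul (n : N) (a : A) :
    inducedCoact k H A N (BTensor.tmul k (coinvariantAlgebra k H A) n a) =
      (BTensor.mk k _ N A n).rTensor H (coact k H A a) := rfl

/-- The induction functor on objects: `N ⊗_B A` is a right `H`-comodule. -/
instance : RightComodule k H (BTensor k (coinvariantAlgebra k H A) N A) where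
  coact := inducedCoact k H A N
  coassoc t := by
    suffices h : (TensorProduct.assoc k _ H H).toLinearMap ∘ₗ
        (inducedCoact k H A N).rTensor H ∘ₗ inducedCoact k H A N =
        (Coalgebra.comul (R := k) (A := H)).lTensor _ ∘ₗ inducedCoact k H A N from congr($h t)
    ext n a
    have h1 : (inducedCoact k H A N) ∘ₗ BTensor.mk k _ N A n =
      (BTensor.mk k _ N A n).rTensor H ∘ₗ coact k H A := rfl
    have h2 : ∀ s : (A ⊗[k] H) ⊗[k] H, TensorProduct.assoc k _ H H
        (((BTensor.mk k (coinvariantAlgebra k H A) N A n).rTensor H).rTensor H s) =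
        (BTensor.mk k _ N A n).rTensor (H ⊗[k] H) (TensorProduct.assoc k A H H s) := by
      intro s
      have : (TensorProduct.assoc k _ H H).toLinearMap ∘ₗ
          ((BTensor.mk k (coinvariantAlgebra k H A) N A n).rTensor H).rTensor H =
          (BTensor.mk k _ N A n).rTensor (H ⊗[k] H) ∘ₗ
            (TensorProduct.assoc k A H H).toLinearMap := by ext; simp
      exact congr($this s)
    simp only [LinearMap.comp_apply, LinearEquiv.coe_coe, inducedCoact_tmul]
    rw [← LinearMap.rTensor_comp_apply, h1, LinearMap.rTensor_comp_apply, h2,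
      RightComodule.coassoc]
    exact congr($((LinearMap.rTensor_comp_lTensor _ _ _).trans
      (LinearMap.lTensor_comp_rTensor _ _ _).symm) (coact k H A a))
  counit t := by
    suffices h : (Coalgebra.counit (R := k) (A := H)).lTensor _ ∘ₗ inducedCoact k H A N =
        (TensorProduct.mk k _ k).flip 1 from congr($h t)
    ext n a
    simp only [LinearMap.comp_apply, inducedCoact_tmul]
    rw [← LinearMap.comp_apply, LinearMap.lTensor_comp_rTensor, ← LinearMap.rTensor_comp_lTensor,
      LinearMap.comp_apply, RightComodule.counit]
    rfl

end HopfGalois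

section Calculi

/-- A first order differential calculus `(Ω, d)` on an algebra `A`: a `k`-linear derivation with
values in the `A`-bimodule `Ω = Ω¹(A)`. -/
structure FirstOrderCalculus (k : Type u) (A : Type v) (Ω : Type x) [CommRing k] [Ring A]
    [Algebra k A] [AddCommGroup Ω] [Module k Ω] [Module A Ω] [Module Aᵐᵒᵖ Ω] where
  d : A →ₗ[k] Ω
  leibniz : ∀ a b : A, d (a * b) = op b • d a + a • d b

/-- `∇ : Hom_A(Ω, M) → M` is a (right) hom-connection: `∇(f a) = ∇(f) a + f(da)`, where
`(f a)(ω) = f(a ω)`. -/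
def IsHomConnection {k : Type u} {A : Type v} {Ω : Type x} {M : Type y} [CommRing k] [Ring A]
    [Algebra k A] [AddCommGroup Ω] [Module k Ω] [Module A Ω] [Module Aᵐᵒᵖ Ω]
    [SMulCommClass A Aᵐᵒᵖ Ω] [AddCommGroup M] [Module k M] [Module Aᵐᵒᵖ M] [IsScalarTower k Aᵐᵒᵖ M]
    (D : FirstOrderCalculus k A Ω) (nabla : (Ω →ₗ[Aᵐᵒᵖ] M) →ₗ[k] M) : Prop :=
  ∀ (f : Ω →ₗ[Aᵐᵒᵖ] M) (a : A),
    nabla (f ∘ₗ DistribSMul.toLinearMap Aᵐᵒᵖ Ω a) = op a • nabla f + f (D.d a)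

namespace FirstOrderCalculus

variable {k : Type u} (H : Type w) {A : Type v} {Ω : Type x} [CommRing k] [Ring H]
  [HopfAlgebra k H] [Ring A] [Algebra k A] [ComoduleAlgebra k H A]
  [AddCommGroup Ω] [Module k Ω] [Module A Ω] [Module Aᵐᵒᵖ Ω] [SMulCommClass A Aᵐᵒᵖ Ω]
  [IsScalarTower k A Ω] [IsScalarTower k Aᵐᵒᵖ Ω] (D : FirstOrderCalculus k A Ω)

/-- Covariance of a calculus: `Ω` is a relative Hopf module and `d` is colinear. -/
structure IsCovariant [RightComodule k H Ω] : Prop where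
  relativeHopfModule : RelativeHopfModule k H A Ω
  colinear : IsColinear k H D.d

/-- The forms on the base `B = A^{coH}`: `Ω¹(B) = B dB`, the span of all `b db'` in `Ω¹(A)`. -/
def baseForms : Submodule k Ω :=
  Submodule.span k {ω | ∃ b b' : coinvariantAlgebra k H A, ω = (b : A) • D.d (b' : A)}

theorem smul_mem_baseForms (b : coinvariantAlgebra k H A) {ω : Ω} (hω : ω ∈ D.baseForms H) :
    (b : A) • ω ∈ D.baseForms H := by
  induction hω using Submodule.span_induction with
  | mem x hx =>
    obtain ⟨c, c', rfl⟩ := hx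
    exact Submodule.subset_span ⟨b * c, c', by simp [mul_smul]⟩
  | zero => simp
  | add x y _ _ hx hy => rw [smul_add]; exact add_mem hx hy
  | smul c x _ hx =>
    rw [smul_comm]
    exact Submodule.smul_mem _ c hx

theorem op_smul_mem_baseForms (b : coinvariantAlgebra k H A) {ω : Ω} (hω : ω ∈ D.baseForms H) :
    op (b : A) • ω ∈ D.baseForms H := by
  induction hω using Submodule.span_induction with
  | mem x hx =>
    obtain ⟨c, c', rfl⟩ := hx
    have h : op (b : A) • (c : A) • D.d (c' : A) =
        (c : A) • D.d ((c' * b : coinvariantAlgebra k H A) : A) -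
          ((c * c' : coinvariantAlgebra k H A) : A) • D.d (b : A) := by
      rw [Subalgebra.coe_mul, Subalgebra.coe_mul, D.leibniz, smul_add, mul_smul,
        add_sub_cancel_right, ← smul_comm]
    rw [h]
    exact sub_mem (Submodule.subset_span ⟨_, _, rfl⟩) (Submodule.subset_span ⟨_, _, rfl⟩)
  | zero => simp
  | add x y _ _ hx hy => rw [smul_add]; exact add_mem hx hy
  | smul c x _ hx =>
    rw [smul_comm]
    exact Submodule.smul_mem _ c hx

theorem d_mem_baseForms (b : coinvariantAlgebra k H A) : D.d (b : A) ∈ D.baseForms H :=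
  Submodule.subset_span ⟨1, b, by simp⟩

/-- The `B`-bimodule structure of `Ω¹(B)`. -/
instance : Module (coinvariantAlgebra k H A) (D.baseForms H) where
  smul b m := ⟨(b : A) • (m : Ω), D.smul_mem_baseForms H b m.2⟩
  one_smul m := Subtype.ext (one_smul A (m : Ω))
  mul_smul b c m := Subtype.ext (mul_smul (b : A) (c : A) (m : Ω))
  smul_zero b := Subtype.ext (smul_zero (b : A))
  smul_add b m n := Subtype.ext (smul_add (b : A) (m : Ω) n)
  add_smul b c m := Subtype.ext (add_smul (b : A) (c : A) (m : Ω))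
  zero_smul m := Subtype.ext (zero_smul A (m : Ω))

instance : Module (↥(coinvariantAlgebra k H A))ᵐᵒᵖ (D.baseForms H) where
  smul b m := ⟨b • (m : Ω), D.op_smul_mem_baseForms H b.unop m.2⟩
  one_smul m := Subtype.ext (one_smul _ (m : Ω))
  mul_smul b c m := Subtype.ext (mul_smul b c (m : Ω))
  smul_zero b := Subtype.ext (smul_zero b)
  smul_add b m n := Subtype.ext (smul_add b (m : Ω) n)
  add_smul b c m := Subtype.ext (add_smul b c (m : Ω))
  zero_smul m := Subtype.ext (zero_smul _ (m : Ω))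

instance : SMulCommClass (coinvariantAlgebra k H A) (↥(coinvariantAlgebra k H A))ᵐᵒᵖ
    (D.baseForms H) where
  smul_comm b c m := Subtype.ext (smul_comm (b : A) (op ((c.unop : _) : A)) (m : Ω))

instance : IsScalarTower k (coinvariantAlgebra k H A) (D.baseForms H) where
  smul_assoc c b m := Subtype.ext (smul_assoc c (b : A) (m : Ω))

instance : IsScalarTower k (↥(coinvariantAlgebra k H A))ᵐᵒᵖ (D.baseForms H) where
  smul_assoc c b m := Subtype.ext (smul_assoc c b (m : Ω))

/-- The calculus `(Ω¹(B), d)` on `B = A^{coH}`, with `d` the restriction of `d` on `A`. -/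
def base : FirstOrderCalculus k (coinvariantAlgebra k H A) (D.baseForms H) where
  d := (D.d ∘ₗ (coinvariantAlgebra k H A).val.toLinearMap).codRestrict (D.baseForms H)
    (D.d_mem_baseForms H)
  leibniz a b := Subtype.ext (D.leibniz (a : A) (b : A))

/-- The right `A`-module and `H`-comodule `Ω¹(B) ⊗_B A`. -/
abbrev inducedForms : Type max x v :=
  BTensor k (coinvariantAlgebra k H A) (D.baseForms H) A

/-- For a right `B`-linear `f : Ω¹(B) → M^{coH}`, the right `A`-linear map
`f̂ : Ω¹(B) ⊗_B A → M`, `ω ⊗_B a ↦ f(ω) a`. -/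
def hat {M : Type y} [AddCommGroup M] [Module k M] [Module Aᵐᵒᵖ M] [IsScalarTower k Aᵐᵒᵖ M]
    [RightComodule k H M] [RelativeHopfModule k H A M]
    (f : D.baseForms H →ₗ[(↥(coinvariantAlgebra k H A))ᵐᵒᵖ] coinvariants k H M) :
    D.inducedForms H →ₗ[Aᵐᵒᵖ] M :=
  BTensor.liftRight ((rightAct k A M) ∘ₗ (coinvariants k H M).subtype ∘ₗ f.restrictScalars k)
    (fun n b a => by
      change op a • ((f (op b • n) : coinvariants k H M) : M) =
        op ((b : A) * a) • ((f n : coinvariants k H M) : M)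
      rw [map_smul, MulOpposite.op_mul, mul_smul]
      rfl)
    (fun n a a' => by
      change op (a * a') • ((f n : coinvariants k H M) : M) = _
      rw [MulOpposite.op_mul, mul_smul]
      rfl)

/-- The map `j : Ω¹(B) ⊗_B A → Ω¹(A)`, `ω ⊗_B a ↦ ω a`. -/
def j : D.inducedForms H →ₗ[Aᵐᵒᵖ] Ω :=
  BTensor.liftRight ((rightAct k A Ω) ∘ₗ (D.baseForms H).subtype)
    (fun n b a => by
      change op a • op (b : A) • (n : Ω) = op ((b : A) * a) • (n : Ω)
      rw [MulOpposite.op_mul, mul_smul])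
    (fun n a a' => by
      change op (a * a') • (n : Ω) = _
      rw [MulOpposite.op_mul, mul_smul]
      rfl)

end FirstOrderCalculus

end Calculi

/-! ### Linearity and colinearity of `f ↦ f̂`. -/

namespace FirstOrderCalculus

variable {k : Type u} (H : Type w) {A : Type v} {Ω : Type x} [CommRing k] [Ring H]
  [HopfAlgebra k H] [Ring A] [Algebra k A] [ComoduleAlgebra k H A]
  [AddCommGroup Ω] [Module k Ω] [Module A Ω] [Module Aᵐᵒᵖ Ω] [SMulCommClass A Aᵐᵒᵖ Ω]
  [IsScalarTower k A Ω] [IsScalarTower k Aᵐᵒᵖ Ω] (D : FirstOrderCalculus k A Ω)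
  {M : Type y} [AddCommGroup M] [Module k M] [Module Aᵐᵒᵖ M] [IsScalarTower k Aᵐᵒᵖ M]
  [RightComodule k H M] [RelativeHopfModule k H A M]

/-! The formula `f ↦ ∇(f̂ ∘ Π)` raises two questions: whether its values are coinvariant, and
whether it satisfies the Leibniz rule over `B`.

Coinvariance: since `f` takes values in `M^{coH}`, the element `f(ω) a` coacts only through `a`,
exactly as `ω ⊗_B a` does. So `f̂` is colinear (`isColinear_hat`), hence so is `f̂ ∘ Π`, and by
assumption `∇` sends such maps to coinvariants.

Leibniz rule: for `b ∈ B` the map attached to `f b` is `f̂` precomposed with the left action of `b`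
on `Ω¹(B) ⊗_B A` (`hat_comp_smul`). Left `B`-linearity of `Π` moves this action to `Ω¹(A)`, so the
map associated with `f b` is `(f̂ ∘ Π) b`. The Leibniz rule of `∇` at `b ∈ A` then gives `∇(f̂ ∘ Π)
b + f̂(Π(db))`. As `db = j(db ⊗_B 1)` and `Π` retracts `j`, the last term is `f̂(db ⊗_B 1) = f(db)`.
-/

@[simp] theorem hat_tmul
    (f : D.baseForms H →ₗ[(↥(coinvariantAlgebra k H A))ᵐᵒᵖ] coinvariants k H M)
    (n : D.baseForms H) (a : A) :
    D.hat H f (BTensor.tmul k (coinvariantAlgebra k H A) n a) = op a • (f n : M) := rfl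

@[simp] theorem j_tmul (n : D.baseForms H) (a : A) :
    D.j H (BTensor.tmul k (coinvariantAlgebra k H A) n a) = op a • (n : Ω) := rfl

/-- Linear maps out of `Ω¹(B) ⊗_B A` are determined on pure tensors. -/
theorem inducedForms_hom_ext {X : Type y} [AddCommGroup X] [Module k X]
    {f g : D.inducedForms H →ₗ[k] X}
    (h : ∀ n a, f (BTensor.tmul k (coinvariantAlgebra k H A) n a) = g (BTensor.tmul k _ n a))
    (t : D.inducedForms H) : f t = g t :=
  congr($(BTensor.hom_ext h) t)

/-- Together with `hat_smul`, this makes `f ↦ ∇(f̂ ∘ Π)` a `k`-linear map. Both reduce to pure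
tensors, where the action of `a` on `M` is additive and commutes with scalars. -/
theorem hat_add (f g : D.baseForms H →ₗ[(↥(coinvariantAlgebra k H A))ᵐᵒᵖ] coinvariants k H M) :
    D.hat H (f + g) = D.hat H f + D.hat H g :=
  LinearMap.ext <| D.inducedForms_hom_ext H (f := (D.hat H (f + g)).restrictScalars k)
    (g := (D.hat H f + D.hat H g).restrictScalars k) fun n a => smul_add (op a) (f n : M) (g n)

theorem hat_smul (c : k)
    (f : D.baseForms H →ₗ[(↥(coinvariantAlgebra k H A))ᵐᵒᵖ] coinvariants k H M) :
    D.hat H (c • f) = c • D.hat H f :=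
  LinearMap.ext <| D.inducedForms_hom_ext H (f := (D.hat H (c • f)).restrictScalars k)
    (g := (c • D.hat H f).restrictScalars k) fun n a => smul_comm (op a) c (f n : M)

/-- The map `f ↦ f̂` turns the right action of `B` on `Hom_B(Ω¹(B), M^{coH})` into
precomposition with the left action of `B` on `Ω¹(B) ⊗_B A`. -/
theorem hat_comp_smul
    (f : D.baseForms H →ₗ[(↥(coinvariantAlgebra k H A))ᵐᵒᵖ] coinvariants k H M)
    (b : coinvariantAlgebra k H A) (t : D.inducedForms H) :
    D.hat H (f ∘ₗ DistribSMul.toLinearMap (↥(coinvariantAlgebra k H A))ᵐᵒᵖ (D.baseForms H) b) t =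
      D.hat H f (b • t) :=
  D.inducedForms_hom_ext H
    (f := (D.hat H (f ∘ₗ DistribSMul.toLinearMap (↥(coinvariantAlgebra k H A))ᵐᵒᵖ
      (D.baseForms H) b)).restrictScalars k)
    -- The left action of `b` on the balanced tensor product is by definition `BTensor.map` of `b`
    -- and the identity, so this is `t ↦ f̂(b t)` as a `k`-linear map. On pure tensors both sides
    -- are `f(b ω) a`.
    (g := (D.hat H f).restrictScalars k ∘ₗ
      BTensor.map (k := k) (DistribSMul.toLinearMap (↥(coinvariantAlgebra k H A))ᵐᵒᵖ
        (D.baseForms H) b) LinearMap.id)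
    (fun _ _ => rfl) t

/-- The map `f̂` is right `H`-colinear. -/
theorem isColinear_hat
    (f : D.baseForms H →ₗ[(↥(coinvariantAlgebra k H A))ᵐᵒᵖ] coinvariants k H M) :
    IsColinear k H ((D.hat H f).restrictScalars k) := by
  intro t
  suffices h : coact k H M ∘ₗ (D.hat H f).restrictScalars k =
      ((D.hat H f).restrictScalars k).rTensor H ∘ₗ coact k H (D.inducedForms H) from congr($h t)
  refine BTensor.hom_ext fun n a => ?_
  change coact k H M (op a • (f n : M)) = ((D.hat H f).restrictScalars k).rTensor H
    ((BTensor.mk k (coinvariantAlgebra k H A) (D.baseForms H) A n).rTensor H (coact k H A a))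
  -- The only use of the values of `f` being coinvariant: the coaction of `f(ω) a` becomes `f(ω) a₀
  -- ⊗ 1 · a₁`.
  rw [RelativeHopfModule.coact_smul, show coact k H M (f n : M) = (f n : M) ⊗ₜ[k] (1 : H) from
    (f n).2]
  -- Both sides are now additive in `ϱ(a)`, so the identity can be proved for an arbitrary element
  -- of `A ⊗ H` in its place.
  induction coact k H A a with
  | zero => simp
  | add s t hs ht => rw [map_add, map_add, map_add, hs, ht]
  | tmul a h => simp [rightAct]

end FirstOrderCalculus

/-! ### The induced hom-connection on `M^{coH}`. -/

theorem mainTheorem4 {k : Type u} {H : Type w} {A : Type v} {Ω : Type x} {M : Type y}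
    [Field k] [Ring H] [HopfAlgebra k H] [Ring A] [Algebra k A] [ComoduleAlgebra k H A]
    -- `B = A^{coH} ⊆ A` is a Hopf-Galois extension, faithfully flat as a left `B`-module
    (hGalois : IsHopfGalois k H A)
    (hFlat : IsFaithfullyFlatLeft k (coinvariantAlgebra k H A) A)
    -- a covariant first order differential calculus `(Ω, d)` on `A`
    [AddCommGroup Ω] [Module k Ω] [Module A Ω] [Module Aᵐᵒᵖ Ω] [SMulCommClass A Aᵐᵒᵖ Ω]
    [IsScalarTower k A Ω] [IsScalarTower k Aᵐᵒᵖ Ω] [RightComodule k H Ω]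
    (D : FirstOrderCalculus k A Ω) (hD : D.IsCovariant H)
    -- a right `A`-linear, left `B`-linear, right `H`-colinear retraction of `j`
    (Pi : Ω →ₗ[Aᵐᵒᵖ] D.inducedForms H)
    (hPi_left : ∀ (b : coinvariantAlgebra k H A) (ω : Ω), Pi ((b : A) • ω) = b • Pi ω)
    (hPi_colinear : IsColinear k H (Pi.restrictScalars k))
    (hPi_j : ∀ t : D.inducedForms H, Pi (D.j H t) = t)
    -- a relative Hopf module `M` with a hom-connection
    [AddCommGroup M] [Module k M] [Module Aᵐᵒᵖ M] [IsScalarTower k Aᵐᵒᵖ M] [RightComodule k H M]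
    [RelativeHopfModule k H A M]
    (nabla : (Ω →ₗ[Aᵐᵒᵖ] M) →ₗ[k] M) (hnabla : IsHomConnection D nabla)
    (hnabla_coinv : ∀ f : Ω →ₗ[Aᵐᵒᵖ] M, IsColinear k H (f.restrictScalars k) →
      nabla f ∈ coinvariants k H M) :
    ∃ nablaCo : (D.baseForms H →ₗ[(↥(coinvariantAlgebra k H A))ᵐᵒᵖ] coinvariants k H M) →ₗ[k]
        coinvariants k H M,
      IsHomConnection (D.base H) nablaCo ∧
      ∀ f : D.baseForms H →ₗ[(↥(coinvariantAlgebra k H A))ᵐᵒᵖ] coinvariants k H M,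
        (nablaCo f : M) = nabla (D.hat H f ∘ₗ Pi) := by
  -- The composite of the colinear maps `Π` and `f̂` is colinear, so the coinvariance assumption on
  -- `∇` applies to it.
  have hcoinv : ∀ f : D.baseForms H →ₗ[(↥(coinvariantAlgebra k H A))ᵐᵒᵖ] coinvariants k H M,
      nabla (D.hat H f ∘ₗ Pi) ∈ coinvariants k H M := by
    refine fun f => hnabla_coinv _ fun ω => ?_
    refine (D.isColinear_hat H f (Pi ω)).trans ?_
    rw [show coact k H (D.inducedForms H) (Pi ω) = _ from hPi_colinear ω,
      ← LinearMap.rTensor_comp_apply]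
    rfl
  refine ⟨LinearMap.codRestrict (coinvariants k H M)
    { toFun f := nabla (D.hat H f ∘ₗ Pi)
      map_add' f g := by rw [D.hat_add H, LinearMap.add_comp, map_add]
      map_smul' c f := by rw [D.hat_smul H, LinearMap.smul_comp, map_smul, RingHom.id_apply] }
    hcoinv, fun f b => Subtype.ext ?_, fun f => rfl⟩
  -- Compatibility with the two right actions on Hom spaces: `f b` over `B` goes to `(f̂ ∘ Π) b`
  -- over `A`. This is where left `B`-linearity of `Π` enters.
  have hsmul : D.hat H
      (f ∘ₗ DistribSMul.toLinearMap (↥(coinvariantAlgebra k H A))ᵐᵒᵖ (D.baseForms H) b) ∘ₗ Pi =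
      (D.hat H f ∘ₗ Pi) ∘ₗ DistribSMul.toLinearMap Aᵐᵒᵖ Ω (b : A) := by
    ext ω
    change D.hat H _ (Pi ω) = D.hat H f (Pi ((b : A) • ω))
    rw [D.hat_comp_smul H, hPi_left]
  -- Since `db` already lies in `Ω¹(B)`, it equals `j(db ⊗_B 1)`, and the retraction property
  -- determines `Π` there.
  have hd : Pi (D.d (b : A)) =
      BTensor.tmul k (coinvariantAlgebra k H A) ((D.base H).d b) (1 : A) := by
    rw [← hPi_j (BTensor.tmul k _ ((D.base H).d b) 1), D.j_tmul H, MulOpposite.op_one, one_smul]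
    rfl
  -- The Leibniz rule over `B`, read in `M` through the inclusion of `M^{coH}`; it becomes the rule
  -- for `∇` at the map `f̂ ∘ Π` and the element `b` of `A`.
  change nabla (D.hat H _ ∘ₗ Pi) =
    op (b : A) • nabla (D.hat H f ∘ₗ Pi) + (f ((D.base H).d b) : M)
  rw [hsmul, hnabla, LinearMap.comp_apply, hd, D.hat_tmul H, MulOpposite.op_one, one_smul]
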